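/- Let $(\mathscr{C},\mathbb{E},\mathfrak{s})$ be a Krull–Schmidt extriangulated category (in the sense of Nakaoka–Palu) with enough projectives and enough injectives. For $i\ge 0$ put $\mathbb{E}^{i+1}(X,Y)=\mathbb{E}(\Omega^{i}X,Y)$, where $\Omega^i X$ is an $i$-th syzygy of $X$ (up to isomorphism, this group does not depend on the choice of syzygies). For a class $\mathcal{P}$ of objects of $\mathscr{C}$ let $$\mathcal{P}^{\perp}=\{Y\mid \mathbb{E}^{i}(X,Y)=0\ \ \forall i\ge 1,\ \forall X\in\mathcal{P}\},\qquad {}^{\perp}\mathcal{P}=\{Y\mid \mathbb{E}^{i}(Y,X)=0\ \ \forall i\ge 1,\ \forall X\in\mathcal{P}\},$$ and let $\check{\mathcal{P}}=\bigcup_{n\ge 0}\check{\mathcal{P}}_n$, where $\check{\mathcal{P}}_0$ consists of the objects isomorphic to an object of $\mathcal{P}$, and $A\in\check{\mathcal{P}}_{n+1}$ if and only if there is a conflation $A\to W\to K$ with $W\in\mathcal{P}$ and $K\in\check{\mathcal{P}}_n$ (so $\check{\mathcal{P}}_n$ is the class of objects $A$ having an $\mathbb{E}$-triangle sequence $A\to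 W^0\to W^1\to\cdots\to W^n$ with all $W^i\in\mathcal{P}$). Let $\omega$ be a full additive subcategory of $\mathscr{C}$, closed under isomorphisms and direct summands, that is self-orthogonal: $\mathbb{E}^i(X,Y)=0$ for all $i\ge1$ and all $X,Y\in\omega$. Let ${}_\omega\mathcal{X}$ be the class of all objects $A$ for which there are objects $W_n\in\omega$ and $K_n\in\omega^{\perp}$ $(n\ge 0)$ with $K_0=A$ and conflations $K_{n+1}\to W_n\to K_n$ for all $n\ge0$. Then $$\text{(1)}\quad {}^{\perp}({}_\omega\mathcal{X})\cap \check{{}_\omega\mathcal{X}}=\check{\omega},\qquad\qquad \text{(2)}\quad \bigl({}^{\perp}({}_\omega\mathcal{X})\bigr)^{\perp}\cap \check{{}_\omega\mathcal{X}}={}_\omega\mathcal{X}.$$ -/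

import Mathlib

open CategoryTheory CategoryTheory.Limits Opposite

universe w v u

namespace ExtriCat

section Extensions

variable {C : Type u} [Category.{v} C] [Preadditive C]

/-- For a bifunctor `E : Cᵒᵖ × C → Ab` (in curried form), the group `E(Z, A)` of
`E`-extensions of `Z` by `A`. -/
abbrev Extension (E : Cᵒᵖ ⥤ C ⥤ AddCommGrpCat.{w}) (Z A : C) : Type w :=
  (E.obj (op Z)).obj A

/-- `a_* δ = E(Z, a)(δ)`. -/
def push (E : Cᵒᵖ ⥤ C ⥤ AddCommGrpCat.{w}) {Z A A' : C} (a : A ⟶ A') (δ : Extension E Z A) :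
    Extension E Z A' :=
  (E.obj (op Z)).map a δ

/-- `c^* δ = E(c, A)(δ)`. -/
def pull (E : Cᵒᵖ ⥤ C ⥤ AddCommGrpCat.{w}) {Z Z' A : C} (c : Z' ⟶ Z) (δ : Extension E Z A) :
    Extension E Z' A :=
  (E.map c.op).app A δ

/-- `δ ⊕ δ' ∈ E(Z ⊕ Z', A ⊕ A')`, the element corresponding to `(δ, 0, 0, δ')` under
`E(Z ⊕ Z', A ⊕ A') ≅ E(Z, A) ⊕ E(Z, A') ⊕ E(Z', A) ⊕ E(Z', A')`. -/
noncomputable def dsum [HasBinaryBiproducts C] (E : Cᵒᵖ ⥤ C ⥤ AddCommGrpCat.{w})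
    {Z A Z' A' : C} (δ : Extension E Z A) (δ' : Extension E Z' A') :
    Extension E (Z ⊞ Z') (A ⊞ A') :=
  pull E biprod.fst (push E biprod.inl δ) + pull E biprod.snd (push E biprod.inr δ')

end Extensions

/-- Extriangulated categories `(C, E, s)` in the sense of Nakaoka and Palu; `C` is an additive
category. `Realizes δ x y` says that `s(δ)` is the equivalence class of the sequence
`A --x--> B --y--> Z`; the first three axioms on it say that the sequences realizing a given
`δ` form exactly one equivalence class, where two sequences are equivalent if there is an
isomorphism of their middle terms compatible with the identities of `A` and `Z`. -/
class Extriangulated (C : Type u) [Category.{v} C] [Preadditive C]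
    [HasZeroObject C] [HasBinaryBiproducts C] where
  /-- the bifunctor `E : Cᵒᵖ × C → Ab` -/
  E : Cᵒᵖ ⥤ C ⥤ AddCommGrpCat.{w}
  /-- (ET1): `E` is additive in the first variable. -/
  additive_left : E.Additive
  /-- (ET1): `E` is additive in the second variable. -/
  additive_right : ∀ X : Cᵒᵖ, (E.obj X).Additive
  /-- the correspondence `s` -/
  Realizes : ∀ {A B Z : C}, Extension E Z A → (A ⟶ B) → (B ⟶ Z) → Prop
  exists_realizes : ∀ {A Z : C} (δ : Extension E Z A),
    ∃ (B : C) (x : A ⟶ B) (y : B ⟶ Z), Realizes δ x y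
  realizes_unique : ∀ {A B B' Z : C} (δ : Extension E Z A)
    (x : A ⟶ B) (y : B ⟶ Z) (x' : A ⟶ B') (y' : B' ⟶ Z),
    Realizes δ x y → Realizes δ x' y' → ∃ b : B ≅ B', x ≫ b.hom = x' ∧ b.hom ≫ y' = y
  realizes_of_iso : ∀ {A B B' Z : C} (δ : Extension E Z A)
    (x : A ⟶ B) (y : B ⟶ Z) (x' : A ⟶ B') (y' : B' ⟶ Z) (b : B ≅ B'),
    x ≫ b.hom = x' → b.hom ≫ y' = y → Realizes δ x y → Realizes δ x' y'
  /-- (ET2): `s` is a realization; every morphism `(a, c) : δ → δ'` is realized. -/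
  realizes_map : ∀ {A B Z A' B' Z' : C} (δ : Extension E Z A) (δ' : Extension E Z' A')
    (x : A ⟶ B) (y : B ⟶ Z) (x' : A' ⟶ B') (y' : B' ⟶ Z'),
    Realizes δ x y → Realizes δ' x' y' →
    ∀ (a : A ⟶ A') (c : Z ⟶ Z'), push E a δ = pull E c δ' →
      ∃ b : B ⟶ B', x ≫ b = a ≫ x' ∧ y ≫ c = b ≫ y'
  /-- (ET2): `s(0) = 0`. -/
  realizes_zero : ∀ A Z : C,
    Realizes (0 : Extension E Z A) (biprod.inl : A ⟶ A ⊞ Z) (biprod.snd : A ⊞ Z ⟶ Z)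
  /-- (ET2): `s(δ ⊕ δ') = s(δ) ⊕ s(δ')`. -/
  realizes_dsum : ∀ {A B Z A' B' Z' : C} (δ : Extension E Z A) (δ' : Extension E Z' A')
    (x : A ⟶ B) (y : B ⟶ Z) (x' : A' ⟶ B') (y' : B' ⟶ Z'),
    Realizes δ x y → Realizes δ' x' y' →
    Realizes (dsum E δ δ') (biprod.map x x') (biprod.map y y')
  /-- (ET3) -/
  et3 : ∀ {A B Z A' B' Z' : C} (δ : Extension E Z A) (δ' : Extension E Z' A')
    (x : A ⟶ B) (y : B ⟶ Z) (x' : A' ⟶ B') (y' : B' ⟶ Z'),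
    Realizes δ x y → Realizes δ' x' y' →
    ∀ (a : A ⟶ A') (b : B ⟶ B'), x ≫ b = a ≫ x' →
      ∃ c : Z ⟶ Z', push E a δ = pull E c δ' ∧ y ≫ c = b ≫ y'
  /-- (ET3)ᵒᵖ -/
  et3_op : ∀ {A B Z A' B' Z' : C} (δ : Extension E Z A) (δ' : Extension E Z' A')
    (x : A ⟶ B) (y : B ⟶ Z) (x' : A' ⟶ B') (y' : B' ⟶ Z'),
    Realizes δ x y → Realizes δ' x' y' →
    ∀ (b : B ⟶ B') (c : Z ⟶ Z'), y ≫ c = b ≫ y' →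
      ∃ a : A ⟶ A', push E a δ = pull E c δ' ∧ x ≫ b = a ≫ x'
  /-- (ET4) -/
  et4 : ∀ {A B D M F : C} (δ : Extension E D A) (δ' : Extension E F B)
    (f : A ⟶ B) (f' : B ⟶ D) (g : B ⟶ M) (g' : M ⟶ F),
    Realizes δ f f' → Realizes δ' g g' →
    ∃ (N : C) (d : D ⟶ N) (e : N ⟶ F) (h' : M ⟶ N) (δ'' : Extension E N A),
      f' ≫ d = g ≫ h' ∧ h' ≫ e = g' ∧
      Realizes δ'' (f ≫ g) h' ∧
      Realizes (push E f' δ') d e ∧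
      pull E d δ'' = δ ∧
      push E f δ'' = pull E e δ'
  /-- (ET4)ᵒᵖ -/
  et4_op : ∀ {A B D M F : C} (δ : Extension E B D) (δ' : Extension E M F)
    (f' : D ⟶ A) (f : A ⟶ B) (g' : F ⟶ B) (g : B ⟶ M),
    Realizes δ f' f → Realizes δ' g' g →
    ∃ (N : C) (d : D ⟶ N) (e : N ⟶ F) (h' : N ⟶ A) (δ'' : Extension E M N),
      d ≫ h' = f' ∧ h' ≫ f = e ≫ g' ∧
      Realizes δ'' h' (f ≫ g) ∧
      Realizes (pull E g' δ) d e ∧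
      push E e δ'' = δ' ∧
      push E d δ = pull E g δ''

section

variable {C : Type u} [Category.{v} C] [Preadditive C]
    [HasZeroObject C] [HasBinaryBiproducts C]
  [Extriangulated.{w} C]

/-- The group `E(Z, A)` of extensions of the extriangulated category. -/
abbrev EE (Z A : C) : Type w := Extension (Extriangulated.E (C := C)) Z A

/-- `A --x--> B --y--> Z` is a conflation, i.e. it is part of an `E`-triangle. -/
def IsConflation {A B Z : C} (x : A ⟶ B) (y : B ⟶ Z) : Prop :=
  ∃ δ : EE Z A, Extriangulated.Realizes δ x y

/-- Projective objects, relative to the deflations. -/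
def IsProj (P : C) : Prop :=
  ∀ ⦃A B Z : C⦄ (x : A ⟶ B) (y : B ⟶ Z), IsConflation x y →
    ∀ c : P ⟶ Z, ∃ b : P ⟶ B, b ≫ y = c

/-- Injective objects, relative to the inflations. -/
def IsInj (I : C) : Prop :=
  ∀ ⦃A B Z : C⦄ (x : A ⟶ B) (y : B ⟶ Z), IsConflation x y →
    ∀ a : A ⟶ I, ∃ b : B ⟶ I, x ≫ b = a

end

/-- Every object `Z` is the end of a conflation `A ⟶ P ⟶ Z` with `P` projective. -/
class HasEnoughProj (C : Type u) [Category.{v} C] [Preadditive C]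
    [HasZeroObject C] [HasBinaryBiproducts C] [Extriangulated.{w} C] : Prop where
  exists_conflation : ∀ Z : C, ∃ (A P : C) (x : A ⟶ P) (y : P ⟶ Z), IsProj P ∧ IsConflation x y

/-- Every object `A` is the start of a conflation `A ⟶ I ⟶ Z` with `I` injective. -/
class HasEnoughInj (C : Type u) [Category.{v} C] [Preadditive C]
    [HasZeroObject C] [HasBinaryBiproducts C] [Extriangulated.{w} C] : Prop where
  exists_conflation : ∀ A : C, ∃ (I Z : C) (x : A ⟶ I) (y : I ⟶ Z), IsInj I ∧ IsConflation x y

/-- Krull-Schmidt categories: every object is a finite direct sum of objects with local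
endomorphism rings. -/
class KrullSchmidt (C : Type u) [Category.{v} C] [Preadditive C] : Prop where
  exists_decomposition : ∀ X : C, ∃ (n : ℕ) (f : Fin n → C) (b : Bicone f),
    (∀ i, IsLocalRing (End (f i))) ∧ Nonempty b.IsBilimit ∧ Nonempty (X ≅ b.pt)

/-- Subcategories: full additive subcategories closed under isomorphisms and direct summands,
given by their class of objects. -/
structure IsSubcat {C : Type u} [Category.{v} C] [Preadditive C]
    [HasZeroObject C] [HasBinaryBiproducts C]
    (P : ObjectProperty C) : Prop where
  of_iso : ∀ {X Y : C}, (X ≅ Y) → P X → P Y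
  zero : ∀ {X : C}, IsZero X → P X
  biprod : ∀ {X Y : C}, P X → P Y → P (X ⊞ Y)
  summand : ∀ {X Y : C}, P (X ⊞ Y) → P X

section

variable {C : Type u} [Category.{v} C] [Preadditive C]
    [HasZeroObject C] [HasBinaryBiproducts C]
  [Extriangulated.{w} C]

/-- `coresLE P n` is the class of all `A` with an `E`-triangle sequence
`A ⟶ W⁰ ⟶ W¹ ⟶ ⋯ ⟶ Wⁿ` with all `Wⁱ` in `P`: for `n = 0` this is an isomorphism `A ≅ W⁰`, and
for `n + 1` it is a conflation `A ⟶ W⁰ ⟶ K` with such a sequence of length `n` for `K`. -/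
def coresLE (P : ObjectProperty C) : ℕ → ObjectProperty C
  | 0 => fun A => ∃ W : C, P W ∧ Nonempty (A ≅ W)
  | n + 1 => fun A => ∃ (W K : C) (x : A ⟶ W) (y : W ⟶ K),
      P W ∧ IsConflation x y ∧ coresLE P n K

/-- The class `P̌` of all objects with a finite `P`-coresolution. -/
def cores (P : ObjectProperty C) : ObjectProperty C :=
  fun A => ∃ n : ℕ, coresLE P n A

variable [HasEnoughProj.{w} C]

/-- A chosen syzygy `Ω Z`, the first term of a conflation `Ω Z ⟶ P ⟶ Z` with `P` projective. -/
noncomputable def syzygy (Z : C) : C := (HasEnoughProj.exists_conflation Z).choose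

/-- The iterated syzygy `Ωⁱ Z`. -/
noncomputable def syzygyIter : ℕ → C → C
  | 0, Z => Z
  | i + 1, Z => syzygy (syzygyIter i Z)

/-- The higher extension group `E^{i+1}(X, Y) = E(Ωⁱ X, Y)`, for `i ≥ 0`. -/
abbrev HigherE (i : ℕ) (X Y : C) : Type w := EE (syzygyIter i X) Y

/-- `P^⊥`, the class of all `Y` with `E^{i}(X, Y) = 0` for all `i ≥ 1` and all `X` in `P`. -/
def rightPerp (P : ObjectProperty C) : ObjectProperty C :=
  fun Y => ∀ X : C, P X → ∀ (i : ℕ) (δ : HigherE i X Y), δ = 0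

/-- `^⊥P`, the class of all `Y` with `E^{i}(Y, X) = 0` for all `i ≥ 1` and all `X` in `P`. -/
def leftPerp (P : ObjectProperty C) : ObjectProperty C :=
  fun Y => ∀ X : C, P X → ∀ (i : ℕ) (δ : HigherE i Y X), δ = 0

/-- `P ⊥ P` -/
def SelfOrthogonal (P : ObjectProperty C) : Prop := P ≤ rightPerp P

/-- The class `_P𝒳` of all `A` with an `E`-triangle sequence `⋯ ⟶ W₂ ⟶ W₁ ⟶ W₀ ⟶ A`, spliced
from conflations `Kₙ₊₁ ⟶ Wₙ ⟶ Kₙ` with `K₀ = A`, such that all `Wₙ` are in `P` and all `Kₙ` are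
in `P^⊥`. -/
def properRes (P : ObjectProperty C) : ObjectProperty C :=
  fun A => ∃ K W : ℕ → C, K 0 = A ∧ ∀ n : ℕ, P (W n) ∧ rightPerp P (K n) ∧
    ∃ (g : K (n + 1) ⟶ W n) (f : W n ⟶ K n), IsConflation g f

end

end ExtriCat

/-! Write `𝒳` for `properRes ω`. As in Auslander–Buchweitz theory, each `A` in `cores 𝒳` has two
approximations: a conflation `A ⟶ B ⟶ Z` (`exists_preenvelope`) and a conflation `X ⟶ L ⟶ A`
(`exists_precover`), with `B`, `X` in `𝒳` and `Z`, `L` in `cores ω`. They rest on a horseshoe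
argument showing `𝒳` closed under extensions (`properRes_of_isConflation`).

For (1), let `A` lie in `leftPerp 𝒳`. Since `cores ω ≤ leftPerp 𝒳`, the extension `B` also lies
there. A conflation `K ⟶ W ⟶ B` with `W` in `ω` and `K` in `𝒳` then splits, so `B` is in `ω` and `A`
in `cores ω`.

For (2), let `A` lie in the right perpendicular class of `leftPerp 𝒳`. Then so does `L`, and the
first step `L ⟶ W ⟶ K` of its coresolution splits because `K` is in `leftPerp 𝒳`. Hence `L` is in
`ω`, and `X ⟶ L ⟶ A` starts a proper resolution of `A`. -/

namespace ExtriCat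

open scoped ZeroObject

/-! ### Functoriality of extensions in each variable -/

section Functoriality

variable {C : Type u} [Category.{v} C] (E : Cᵒᵖ ⥤ C ⥤ AddCommGrpCat.{w})

theorem push_zero {Z A A' : C} (a : A ⟶ A') : push E a (0 : Extension E Z A) = 0 :=
  map_zero ((E.obj (op Z)).map a).hom

theorem push_add {Z A A' : C} (a : A ⟶ A') (δ ε : Extension E Z A) :
    push E a (δ + ε) = push E a δ + push E a ε :=
  map_add ((E.obj (op Z)).map a).hom δ ε

theorem pull_zero {Z Z' A : C} (c : Z' ⟶ Z) : pull E c (0 : Extension E Z A) = 0 :=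
  map_zero ((E.map c.op).app A).hom

theorem push_id {Z A : C} (δ : Extension E Z A) : push E (𝟙 A) δ = δ := by
  simp [push]

theorem pull_id {Z A : C} (δ : Extension E Z A) : pull E (𝟙 Z) δ = δ := by
  simp [pull]

theorem push_comp {Z A A' A'' : C} (a : A ⟶ A') (a' : A' ⟶ A'') (δ : Extension E Z A) :
    push E (a ≫ a') δ = push E a' (push E a δ) := by
  simp [push]

theorem pull_comp {Z Z' Z'' A : C} (c' : Z'' ⟶ Z') (c : Z' ⟶ Z) (δ : Extension E Z A) :
    pull E (c' ≫ c) δ = pull E c' (pull E c δ) := by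
  simp [pull]

theorem push_pull {Z Z' A A' : C} (a : A ⟶ A') (c : Z' ⟶ Z) (δ : Extension E Z A) :
    push E a (pull E c δ) = pull E c (push E a δ) := by
  have h := (E.map c.op).naturality a
  exact (ConcreteCategory.congr_hom h δ).symm

end Functoriality

/-! ### Exact sequences, splittings and pullbacks of conflations -/

section Triangles

variable {C : Type u} [Category.{v} C] [Preadditive C] [HasZeroObject C] [HasBinaryBiproducts C]
  [Extriangulated.{w} C]

open Extriangulated

theorem push_zero_hom {Z A A' : C} (δ : EE Z A) :
    push (E (C := C)) (0 : A ⟶ A') δ = 0 := by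
  have := additive_right (C := C) (op Z)
  simp [push]

theorem pull_eq_zero {A B Z : C} {δ : EE Z A} {x : A ⟶ B} {y : B ⟶ Z} (h : Realizes δ x y) :
    pull E y δ = 0 := by
  obtain ⟨a, ha, -⟩ := et3_op _ _ _ _ _ _ (realizes_zero A B) h biprod.snd y rfl
  rw [← ha, push_zero]

theorem push_eq_zero {A B Z : C} {δ : EE Z A} {x : A ⟶ B} {y : B ⟶ Z} (h : Realizes δ x y) :
    push E x δ = 0 := by
  obtain ⟨c, hc, -⟩ := et3 _ _ _ _ _ _ h (realizes_zero B Z) x biprod.inl rfl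
  rw [hc, pull_zero]

theorem pull_eq_zero_of_factors {A B Z Z' : C} {δ : EE Z A} {x : A ⟶ B} {y : B ⟶ Z}
    (h : Realizes δ x y) (b : Z' ⟶ B) : pull E (b ≫ y) δ = 0 := by
  rw [pull_comp, pull_eq_zero h, pull_zero]

theorem push_eq_zero_of_factors {A B Z A' : C} {δ : EE Z A} {x : A ⟶ B} {y : B ⟶ Z}
    (h : Realizes δ x y) (b : B ⟶ A') : push E (x ≫ b) δ = 0 := by
  rw [push_comp, push_eq_zero h, push_zero]

theorem exists_lift {A B Z Z' : C} {δ : EE Z A} {x : A ⟶ B} {y : B ⟶ Z}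
    (h : Realizes δ x y) (c : Z' ⟶ Z) (hc : pull E c δ = 0) : ∃ b : Z' ⟶ B, b ≫ y = c := by
  obtain ⟨b, -, hb⟩ := realizes_map _ _ _ _ _ _ (realizes_zero A Z') h (𝟙 A) c
    (by rw [push_zero, hc])
  exact ⟨biprod.inr ≫ b, by rw [Category.assoc, ← hb, biprod.inr_snd_assoc]⟩

theorem exists_extension {A B Z A' : C} {δ : EE Z A} {x : A ⟶ B} {y : B ⟶ Z}
    (h : Realizes δ x y) (a : A ⟶ A') (ha : push E a δ = 0) : ∃ b : B ⟶ A', x ≫ b = a := by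
  obtain ⟨b, hb, -⟩ := realizes_map _ _ _ _ _ _ h (realizes_zero A' Z) a (𝟙 Z)
    (by rw [pull_zero, ha])
  exact ⟨b ≫ biprod.fst, by rw [← Category.assoc, hb, Category.assoc, biprod.inl_fst,
    Category.comp_id]⟩

/-- `Hom(Z, -) ⟶ Hom(B, -) ⟶ Hom(A, -)` is exact. -/
theorem exists_desc {A B Z W : C} {x : A ⟶ B} {y : B ⟶ Z} (h : IsConflation x y) (f : B ⟶ W)
    (hf : x ≫ f = 0) : ∃ c : Z ⟶ W, y ≫ c = f := by
  obtain ⟨δ, h⟩ := h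
  obtain ⟨c, -, hc⟩ := et3 _ _ _ _ _ _ h (realizes_zero (0 : C) W) 0 (f ≫ biprod.inr)
    (by rw [← Category.assoc, hf, zero_comp, zero_comp])
  exact ⟨c, by rw [hc, Category.assoc, biprod.inr_snd, Category.comp_id]⟩

/-- `Hom(-, A) ⟶ Hom(-, B) ⟶ Hom(-, Z)` is exact. -/
theorem exists_factor {A B Z W : C} {x : A ⟶ B} {y : B ⟶ Z} (h : IsConflation x y) (f : W ⟶ B)
    (hf : f ≫ y = 0) : ∃ a : W ⟶ A, a ≫ x = f := by
  obtain ⟨δ, h⟩ := h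
  obtain ⟨a, -, ha⟩ := et3_op _ _ _ _ _ _ (realizes_zero W (0 : C)) h (biprod.fst ≫ f) 0
    (by rw [Category.assoc, hf, comp_zero, comp_zero])
  exact ⟨a, by rw [← ha, biprod.inl_fst_assoc]⟩

/-- `Hom(A, -) ⟶ E(Z, -) ⟶ E(B, -)` is exact. -/
theorem exists_push_eq {A B Z Y : C} {δ : EE Z A} {x : A ⟶ B} {y : B ⟶ Z} (h : Realizes δ x y)
    (β : EE Z Y) (hβ : pull E y β = 0) : ∃ a : A ⟶ Y, push E a δ = β := by
  obtain ⟨M, m, n, hm⟩ := exists_realizes β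
  obtain ⟨b, hb⟩ := exists_lift hm y hβ
  obtain ⟨a, ha, -⟩ := et3_op _ _ _ _ _ _ h hm b (𝟙 Z) (by rw [hb, Category.comp_id])
  exact ⟨a, by rw [ha, pull_id]⟩

/-- `Hom(-, Z) ⟶ E(-, A) ⟶ E(-, B)` is exact. -/
theorem exists_pull_eq {A B Z X : C} {δ : EE Z A} {x : A ⟶ B} {y : B ⟶ Z} (h : Realizes δ x y)
    (β : EE X A) (hβ : push E x β = 0) : ∃ c : X ⟶ Z, pull E c δ = β := by
  obtain ⟨M, m, n, hm⟩ := exists_realizes β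
  obtain ⟨b, hb⟩ := exists_extension hm x hβ
  obtain ⟨c, hc, -⟩ := et3 _ _ _ _ _ _ hm h (𝟙 A) b (by rw [hb, Category.id_comp])
  exact ⟨c, by rw [← hc, push_id]⟩

/-- The vanishing of `E(Z, Y)`. -/
def ExtZero (Z Y : C) : Prop := ∀ δ : EE Z Y, δ = 0

theorem IsProj.extZero {P : C} (hP : IsProj P) (Y : C) : ExtZero P Y := fun δ ↦ by
  obtain ⟨M, m, n, hm⟩ := exists_realizes δ
  obtain ⟨b, hb⟩ := hP m n ⟨δ, hm⟩ (𝟙 P)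
  rw [← pull_id E δ, ← hb, pull_eq_zero_of_factors hm]

theorem IsInj.extZero {I : C} (hI : IsInj I) (X : C) : ExtZero X I := fun δ ↦ by
  obtain ⟨M, m, n, hm⟩ := exists_realizes δ
  obtain ⟨b, hb⟩ := hI m n ⟨δ, hm⟩ (𝟙 I)
  rw [← push_id E δ, ← hb, push_eq_zero_of_factors hm]

theorem extZero_iff_extends {A P Z : C} {x : A ⟶ P} {y : P ⟶ Z} (hP : IsProj P)
    (h : IsConflation x y) (Y : C) :
    ExtZero Z Y ↔ ∀ a : A ⟶ Y, ∃ b : P ⟶ Y, x ≫ b = a := by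
  obtain ⟨δ, h⟩ := h
  refine ⟨fun H a ↦ exists_extension h a (H _), fun H β ↦ ?_⟩
  obtain ⟨a, rfl⟩ := exists_push_eq h β (hP.extZero Y _)
  obtain ⟨b, rfl⟩ := H a
  exact push_eq_zero_of_factors h b

theorem extZero_iff_lifts {A I Z : C} {x : A ⟶ I} {y : I ⟶ Z} (hI : IsInj I)
    (h : IsConflation x y) (X : C) :
    ExtZero X A ↔ ∀ c : X ⟶ Z, ∃ b : X ⟶ I, b ≫ y = c := by
  obtain ⟨δ, h⟩ := h
  refine ⟨fun H c ↦ exists_lift h c (H _), fun H β ↦ ?_⟩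
  obtain ⟨c, rfl⟩ := exists_pull_eq h β (hI.extZero X _)
  obtain ⟨b, rfl⟩ := H c
  exact pull_eq_zero_of_factors h b

/-- Dimension shifting: each side says that every `X' ⟶ Y'` factors as `X' ⟶ P ⟶ I ⟶ Y'`, because
maps `X' ⟶ I` extend to `P` and maps `P ⟶ Y'` lift to `I`. -/
theorem extZero_syzygy_iff {X' P X Y I Y' : C} {x : X' ⟶ P} {y : P ⟶ X} {x' : Y ⟶ I}
    {y' : I ⟶ Y'} (hP : IsProj P) (h : IsConflation x y) (hI : IsInj I)
    (h' : IsConflation x' y') : ExtZero X' Y ↔ ExtZero X Y' := by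
  rw [extZero_iff_lifts hI h', extZero_iff_extends hP h]
  refine forall_congr' fun f ↦ ⟨?_, ?_⟩
  · rintro ⟨b, rfl⟩
    obtain ⟨b', rfl⟩ := hI x y h b
    exact ⟨b' ≫ y', by rw [Category.assoc]⟩
  · rintro ⟨b, rfl⟩
    obtain ⟨b', rfl⟩ := hP x' y' h' b
    exact ⟨x ≫ b', by rw [Category.assoc]⟩

theorem isConflation_of_iso {A A' B Z Z' : C} {x : A ⟶ B} {y : B ⟶ Z} (h : IsConflation x y)
    (a : A ≅ A') (c : Z ≅ Z') : IsConflation (a.inv ≫ x) (y ≫ c.hom) := by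
  obtain ⟨δ, h⟩ := h
  -- `f - 𝟙 B` factors through `y` and is killed by `y`, so its square is zero and `2 - f` inverts
  -- `f`.
  have nilp : ∀ {A B Z : C} {x : A ⟶ B} {y : B ⟶ Z}, IsConflation x y → ∀ f : B ⟶ B,
      x ≫ f = x → f ≫ y = y → IsIso f := by
    intro A B Z x y h f hx hy
    obtain ⟨s, hs⟩ := exists_desc h (f - 𝟙 B) (by simp [hx])
    have hk : (f - 𝟙 B) ≫ (f - 𝟙 B) = 0 := by
      nth_rw 2 [← hs]
      rw [← Category.assoc, Preadditive.sub_comp, hy, Category.id_comp, sub_self, zero_comp]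
    have hk' : f ≫ f = f + f - 𝟙 B := by
      simp only [Preadditive.sub_comp, Preadditive.comp_sub, Category.id_comp,
        Category.comp_id] at hk
      rw [← sub_eq_zero, ← hk]
      abel
    refine ⟨𝟙 B + 𝟙 B - f, ?_, ?_⟩ <;>
      simp [Preadditive.sub_comp, Preadditive.comp_sub, Preadditive.add_comp,
        Preadditive.comp_add, hk']
  obtain ⟨B', x', y', h'⟩ := exists_realizes (push E a.hom (pull E c.inv δ))
  obtain ⟨b, hb₁, hb₂⟩ := realizes_map _ _ _ _ _ _ h h' a.hom c.hom
    (by rw [← push_pull, ← pull_comp, c.hom_inv_id, pull_id])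
  obtain ⟨d, hd₁, hd₂⟩ := realizes_map _ _ _ _ _ _ h' h a.inv c.inv
    (by rw [← push_comp, a.hom_inv_id, push_id])
  have i₁ : IsIso (b ≫ d) := nilp ⟨δ, h⟩ _
    (by rw [← Category.assoc, hb₁, Category.assoc, hd₁, a.hom_inv_id_assoc])
    (by rw [Category.assoc, ← hd₂, ← Category.assoc, ← hb₂, Category.assoc, c.hom_inv_id,
      Category.comp_id])
  have i₂ : IsIso (d ≫ b) := nilp ⟨_, h'⟩ _
    (by rw [← Category.assoc, hd₁, Category.assoc, hb₁, a.inv_hom_id_assoc])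
    (by rw [Category.assoc, ← hb₂, ← Category.assoc, ← hd₂, Category.assoc, c.inv_hom_id,
      Category.comp_id])
  have i : IsIso d := by
    have : IsSplitMono d := ⟨⟨b ≫ inv (d ≫ b), by rw [← Category.assoc, IsIso.hom_inv_id]⟩⟩
    have : Epi d := epi_of_epi b d
    exact isIso_of_epi_of_isSplitMono d
  refine ⟨_, realizes_of_iso _ _ _ _ _ (asIso d) ?_ ?_ h'⟩
  · rw [asIso_hom, hd₁]
  · rw [asIso_hom, ← Category.assoc, ← hd₂, Category.assoc, c.inv_hom_id, Category.comp_id]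

theorem isConflation_iso_right {A B Z : C} (hA : IsZero A) (f : B ≅ Z) :
    IsConflation (0 : A ⟶ B) f.hom := by
  refine ⟨0, realizes_of_iso _ _ _ _ _ ⟨biprod.snd ≫ f.inv, f.hom ≫ biprod.inr, ?_, by simp⟩
    ?_ ?_ (realizes_zero A Z)⟩
  · ext
    · exact hA.eq_of_src _ _
    · exact hA.eq_of_src _ _
    · exact hA.eq_of_tgt _ _
    · simp
  · simp
  · simp

theorem isConflation_iso_left {A B Z : C} (hZ : IsZero Z) (f : A ≅ B) :
    IsConflation f.hom (0 : B ⟶ Z) := by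
  refine ⟨0, realizes_of_iso _ _ _ _ _ ⟨biprod.fst ≫ f.hom, f.inv ≫ biprod.inl, ?_, by simp⟩
    ?_ ?_ (realizes_zero A Z)⟩
  · ext
    · simp
    · exact hZ.eq_of_tgt _ _
    · exact hZ.eq_of_src _ _
    · exact hZ.eq_of_tgt _ _
  · simp
  · exact hZ.eq_of_tgt _ _

theorem isConflation_dsum {A B Z A' B' Z' : C} {x : A ⟶ B} {y : B ⟶ Z} {x' : A' ⟶ B'}
    {y' : B' ⟶ Z'} (h : IsConflation x y) (h' : IsConflation x' y') :
    IsConflation (biprod.map x x') (biprod.map y y') := by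
  obtain ⟨δ, h⟩ := h
  obtain ⟨δ', h'⟩ := h'
  exact ⟨_, realizes_dsum _ _ _ _ _ _ h h'⟩

theorem nonempty_iso_biprod {A B Z : C} {x : A ⟶ B} {y : B ⟶ Z} (h : IsConflation x y)
    (hZA : ExtZero Z A) : Nonempty (B ≅ A ⊞ Z) := by
  obtain ⟨δ, h⟩ := h
  obtain rfl := hZA δ
  obtain ⟨b, -⟩ := realizes_unique _ _ _ _ _ h (realizes_zero A Z)
  exact ⟨b⟩

theorem isConflation_iso_middle {A B B' Z : C} {x : A ⟶ B} {y : B ⟶ Z} (h : IsConflation x y)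
    (b : B ≅ B') : IsConflation (x ≫ b.hom) (b.inv ≫ y) := by
  obtain ⟨δ, h⟩ := h
  exact ⟨δ, realizes_of_iso _ _ _ _ _ b rfl (by simp) h⟩

/-- The pullback of two deflations with the same target. -/
theorem exists_pullback {A₁ B₁ A₂ B₂ Z : C} {x₁ : A₁ ⟶ B₁} {y₁ : B₁ ⟶ Z} {x₂ : A₂ ⟶ B₂}
    {y₂ : B₂ ⟶ Z} (h₁ : IsConflation x₁ y₁) (h₂ : IsConflation x₂ y₂) :
    ∃ (M : C) (m₁ : A₁ ⟶ M) (e₁ : M ⟶ B₂) (m₂ : A₂ ⟶ M) (e₂ : M ⟶ B₁),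
      IsConflation m₁ e₁ ∧ IsConflation m₂ e₂ := by
  obtain ⟨δ₁, h₁⟩ := h₁
  obtain ⟨δ₂, h₂⟩ := h₂
  -- The middle term of `(δ₁, δ₂)` in `E(Z, A₁ ⊞ A₂)` serves as pullback: by (ET4), dividing out one
  -- summand leaves the middle term of the other extension.
  obtain ⟨M, m, e, hM⟩ := exists_realizes
    (push E (biprod.inl : A₁ ⟶ A₁ ⊞ A₂) δ₁ + push E (biprod.inr : A₂ ⟶ A₁ ⊞ A₂) δ₂)
  have h0 : Realizes (0 : EE A₁ A₂) (biprod.inr : A₂ ⟶ A₁ ⊞ A₂) biprod.fst :=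
    realizes_of_iso _ _ _ _ _ (biprod.braiding A₂ A₁) (by ext <;> simp) (by simp) (realizes_zero A₂ A₁)
  obtain ⟨N, d, f, k, ε, -, -, hk, hd, -, -⟩ := et4 _ _ _ _ _ _ (realizes_zero A₁ A₂) hM
  obtain ⟨N', d', f', k', ε', -, -, hk', hd', -, -⟩ := et4 _ _ _ _ _ _ h0 hM
  rw [push_add, ← push_comp, ← push_comp, biprod.inl_snd, biprod.inr_snd, push_zero_hom, push_id,
    zero_add] at hd
  rw [push_add, ← push_comp, ← push_comp, biprod.inl_fst, biprod.inr_fst, push_zero_hom, push_id,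
    add_zero] at hd'
  obtain ⟨b, -⟩ := realizes_unique _ _ _ _ _ hd h₂
  obtain ⟨b', -⟩ := realizes_unique _ _ _ _ _ hd' h₁
  exact ⟨M, _, _, _, _, isConflation_of_iso ⟨_, hk⟩ (Iso.refl _) b,
    isConflation_of_iso ⟨_, hk'⟩ (Iso.refl _) b'⟩

/-- The cocone of a composite of deflations. -/
theorem exists_cocone_comp {D A B F M : C} {f' : D ⟶ A} {f : A ⟶ B} {g' : F ⟶ B} {g : B ⟶ M}
    (h : IsConflation f' f) (h' : IsConflation g' g) :
    ∃ (N : C) (d : D ⟶ N) (e : N ⟶ F) (k : N ⟶ A),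
      IsConflation d e ∧ IsConflation k (f ≫ g) := by
  obtain ⟨δ, h⟩ := h
  obtain ⟨δ', h'⟩ := h'
  obtain ⟨N, d, e, k, ε, -, -, hk, hd, -⟩ := et4_op _ _ _ _ _ _ h h'
  exact ⟨N, d, e, k, ⟨_, hd⟩, ⟨_, hk⟩⟩

end Triangles

/-! ### Closure properties of the perpendicular classes -/

section Orthogonality

variable {C : Type u} [Category.{v} C] [Preadditive C] [HasZeroObject C] [HasBinaryBiproducts C]
  [Extriangulated.{w} C]

open Extriangulated

theorem extZero_middle_right [HasEnoughProj.{w} C] {A B Z X : C} {x : A ⟶ B} {y : B ⟶ Z}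
    (h : IsConflation x y) (hA : ExtZero X A) (hZ : ExtZero X Z) : ExtZero X B := by
  obtain ⟨X', P, p, q, hP, hpq⟩ := HasEnoughProj.exists_conflation.{w} X
  rw [extZero_iff_extends hP hpq] at hA hZ ⊢
  intro f
  obtain ⟨g, hg⟩ := hZ (f ≫ y)
  obtain ⟨k, rfl⟩ := hP x y h g
  obtain ⟨a, ha⟩ := exists_factor h (f - p ≫ k) (by simp [hg])
  obtain ⟨b, rfl⟩ := hA a
  exact ⟨b ≫ x + k, by rw [Preadditive.comp_add, ← Category.assoc, ha, sub_add_cancel]⟩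

theorem extZero_middle_left [HasEnoughInj.{w} C] {A B Z Y : C} {x : A ⟶ B} {y : B ⟶ Z}
    (h : IsConflation x y) (hA : ExtZero A Y) (hZ : ExtZero Z Y) : ExtZero B Y := by
  obtain ⟨I, Y', p, q, hI, hpq⟩ := HasEnoughInj.exists_conflation.{w} Y
  rw [extZero_iff_lifts hI hpq] at hA hZ ⊢
  intro f
  obtain ⟨g, hg⟩ := hA (x ≫ f)
  obtain ⟨k, rfl⟩ := hI x y h g
  obtain ⟨c, hc⟩ := exists_desc h (f - k ≫ q) (by simp [← hg])
  obtain ⟨b, rfl⟩ := hZ c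
  exact ⟨y ≫ b + k, by rw [Preadditive.add_comp, Category.assoc, hc, sub_add_cancel]⟩

variable [HasEnoughProj.{w} C]

theorem rightPerp_of_isConflation {P : ObjectProperty C} {A B Z : C} {x : A ⟶ B} {y : B ⟶ Z}
    (h : IsConflation x y) (hA : rightPerp P A) (hZ : rightPerp P Z) : rightPerp P B :=
  fun X hX i ↦ extZero_middle_right h (hA X hX i) (hZ X hX i)

variable [HasEnoughInj.{w} C]

/-- A chosen cosyzygy of `A`. -/
noncomputable def cosyzygy (A : C) : C :=
  (HasEnoughInj.exists_conflation.{w} A).choose_spec.choose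

theorem extZero_syzygy_cosyzygy (X Y : C) : ExtZero (syzygy X) Y ↔ ExtZero X (cosyzygy Y) := by
  obtain ⟨p, q, hP, hpq⟩ := (HasEnoughProj.exists_conflation.{w} X).choose_spec.choose_spec
  obtain ⟨p', q', hI, hpq'⟩ := (HasEnoughInj.exists_conflation.{w} Y).choose_spec.choose_spec
  exact extZero_syzygy_iff hP hpq hI hpq'

/-- Moving all shifts to `Y` leaves `X` untouched, so closure properties of `leftPerp` can be
checked on a given conflation without forming syzygies of its terms. -/
theorem extZero_syzygyIter (i : ℕ) (X Y : C) :
    ExtZero (syzygyIter i X) Y ↔ ExtZero X (cosyzygy^[i] Y) := by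
  induction i generalizing Y with
  | zero => rfl
  | succ i ih => exact (extZero_syzygy_cosyzygy _ Y).trans (ih _)

theorem leftPerp_iff {P : ObjectProperty C} {A : C} :
    leftPerp P A ↔ ∀ Y, P Y → ∀ i : ℕ, ExtZero A (cosyzygy^[i] Y) :=
  forall₃_congr fun Y _ i ↦ extZero_syzygyIter i A Y

theorem leftPerp_of_isConflation {P : ObjectProperty C} {A B Z : C} {x : A ⟶ B} {y : B ⟶ Z}
    (h : IsConflation x y) (hA : leftPerp P A) (hZ : leftPerp P Z) : leftPerp P B := by
  rw [leftPerp_iff] at *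
  exact fun Y hY i ↦ extZero_middle_left h (hA Y hY i) (hZ Y hY i)

theorem leftPerp_cocone {P : ObjectProperty C} {A B Z : C} {x : A ⟶ B} {y : B ⟶ Z}
    (h : IsConflation x y) (hB : leftPerp P B) (hZ : leftPerp P Z) : leftPerp P A := by
  rw [leftPerp_iff] at *
  intro Y hY i
  obtain ⟨p, q, hI, hpq⟩ :=
    (HasEnoughInj.exists_conflation.{w} (cosyzygy^[i] Y)).choose_spec.choose_spec
  -- One degree more is needed at `Z`: it extends maps from `A` into the next cosyzygy to `B`, where
  -- they lift to the injective.
  have hZ' := hZ Y hY (i + 1)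
  rw [Function.iterate_succ_apply'] at hZ'
  refine (extZero_iff_lifts hI hpq A).2 fun c ↦ ?_
  obtain ⟨δ, hδ⟩ := h
  obtain ⟨c', rfl⟩ := exists_extension hδ c (hZ' _)
  obtain ⟨b, rfl⟩ := (extZero_iff_lifts hI hpq B).1 (hB Y hY i) c'
  exact ⟨x ≫ b, by rw [Category.assoc]⟩

end Orthogonality

/-! ### Finite coresolutions -/

section Coresolutions

variable {C : Type u} [Category.{v} C] [Preadditive C] [HasZeroObject C] [HasBinaryBiproducts C]
  [Extriangulated.{w} C]

theorem le_cores (P : ObjectProperty C) : P ≤ cores P :=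
  fun A hA ↦ ⟨0, A, hA, ⟨Iso.refl A⟩⟩

theorem cores_of_isConflation {P : ObjectProperty C} {A W K : C} {x : A ⟶ W} {y : W ⟶ K}
    (h : IsConflation x y) (hW : P W) (hK : cores P K) : cores P A := by
  obtain ⟨n, hn⟩ := hK
  exact ⟨n + 1, W, K, x, y, hW, h, hn⟩

theorem cores_mono {P Q : ObjectProperty C} (hPQ : P ≤ Q) : cores P ≤ cores Q := by
  rintro A ⟨n, hn⟩
  refine ⟨n, ?_⟩
  induction n generalizing A with
  | zero =>
    obtain ⟨W, hW, h⟩ := hn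
    exact ⟨W, hPQ W hW, h⟩
  | succ n ih =>
    obtain ⟨W, K, x, y, hW, h, hK⟩ := hn
    exact ⟨W, K, x, y, hPQ W hW, h, ih K hK⟩

end Coresolutions

/-! ### The class `properRes ω` and its approximations -/

section Resolutions

variable {C : Type u} [Category.{v} C] [Preadditive C] [HasZeroObject C] [HasBinaryBiproducts C]
  [Extriangulated.{w} C] [HasEnoughProj.{w} C] {ω : ObjectProperty C}

open Extriangulated

/-- Coinduction principle for `properRes`. -/
theorem properRes_of_coinductive (Q : ObjectProperty C)
    (hQ : ∀ A, Q A → rightPerp ω A ∧ ∃ (K W : C) (g : K ⟶ W) (f : W ⟶ A),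
      ω W ∧ Q K ∧ IsConflation g f) : Q ≤ properRes ω := by
  intro A hA
  choose hperp K W g f hW hK hgf using hQ
  let S : ℕ → {A : C // Q A} := fun n ↦ (fun T ↦ ⟨K T.1 T.2, hK T.1 T.2⟩)^[n] ⟨A, hA⟩
  have hS : ∀ n, (S (n + 1)).1 = K (S n).1 (S n).2 := fun n ↦ by
    simp only [S, Function.iterate_succ_apply']
  refine ⟨fun n ↦ (S n).1, fun n ↦ W (S n).1 (S n).2, rfl,
    fun n ↦ ⟨hW _ _, hperp _ (S n).2, ?_⟩⟩
  beta_reduce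
  rw [hS n]
  exact ⟨_, _, hgf _ _⟩

theorem properRes.rightPerp {A : C} (hA : properRes ω A) : rightPerp ω A := by
  obtain ⟨K, W, rfl, h⟩ := hA
  exact (h 0).2.1

theorem properRes.exists_isConflation {A : C} (hA : properRes ω A) :
    ∃ (K W : C) (g : K ⟶ W) (f : W ⟶ A), ω W ∧ properRes ω K ∧ IsConflation g f := by
  obtain ⟨K, W, rfl, h⟩ := hA
  obtain ⟨hW, -, g, f, hgf⟩ := h 0
  exact ⟨K 1, W 0, g, f, hW, ⟨fun n ↦ K (n + 1), fun n ↦ W (n + 1), rfl, fun n ↦ h (n + 1)⟩, hgf⟩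

theorem properRes_of_isConflation_weight {K W A : C} {g : K ⟶ W} {f : W ⟶ A}
    (h : IsConflation g f) (hW : ω W) (hK : properRes ω K) (hA : rightPerp ω A) :
    properRes ω A := by
  -- Adjoining the single object `A` to the class keeps it coinductive.
  refine properRes_of_coinductive (fun B ↦ properRes ω B ∨ B = A) ?_ A (Or.inr rfl)
  rintro B (hB | rfl)
  · obtain ⟨K', W', g', f', h₁, h₂, h₃⟩ := hB.exists_isConflation
    exact ⟨hB.rightPerp, K', W', g', f', h₁, Or.inl h₂, h₃⟩
  · exact ⟨hA, K, W, g, f, hW, Or.inl hK, h⟩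

theorem le_properRes (hω : IsSubcat ω) (hself : SelfOrthogonal ω) : ω ≤ properRes ω :=
  properRes_of_coinductive ω fun A hA ↦ ⟨hself A hA, 0, A, 0, 𝟙 A, hA, hω.zero (isZero_zero C),
    isConflation_iso_right (isZero_zero C) (Iso.refl A)⟩

theorem extZero_of_rightPerp {P : ObjectProperty C} {X Y : C} (hY : rightPerp P Y) (hX : P X) :
    ExtZero X Y :=
  hY X hX 0

/-- `properRes ω` is closed under extensions. -/
theorem properRes_of_isConflation (hω : IsSubcat ω) {A B Z : C} {x : A ⟶ B} {y : B ⟶ Z}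
    (h : IsConflation x y) (hA : properRes ω A) (hZ : properRes ω Z) : properRes ω B := by
  refine properRes_of_coinductive (fun B ↦ ∃ (A Z : C) (x : A ⟶ B) (y : B ⟶ Z),
    properRes ω A ∧ properRes ω Z ∧ IsConflation x y) ?_ B ⟨A, Z, x, y, hA, hZ, h⟩
  rintro B ⟨A, Z, x, y, hA, hZ, h⟩
  refine ⟨rightPerp_of_isConflation h hA.rightPerp hZ.rightPerp, ?_⟩
  obtain ⟨K, W, g, f, hW, hK, hgf⟩ := hA.exists_isConflation
  obtain ⟨K', W', g', f', hW', hK', hgf'⟩ := hZ.exists_isConflation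
  -- Horseshoe: the pullback of `B` and `W'` over `Z` splits as `A ⊞ W'`, since `E(W', A) = 0`.
  -- Composing `W ⊞ W' ⟶ A ⊞ W'` with the deflation onto `B` gives a cocone that is again an
  -- extension of `K'` by `K`.
  obtain ⟨M, m₁, e₁, m₂, e₂, hM₁, hM₂⟩ := exists_pullback h hgf'
  obtain ⟨b⟩ := nonempty_iso_biprod hM₁ (extZero_of_rightPerp hA.rightPerp hW')
  have hM := isConflation_iso_middle hM₂ b
  have hsum := isConflation_dsum hgf (isConflation_iso_right (isZero_zero C) (Iso.refl W'))
  obtain ⟨N, d, e, k, hde, hk⟩ := exists_cocone_comp hsum hM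
  exact ⟨N, W ⊞ W', k, _, hω.biprod hW hW',
    ⟨K, K', _, _, hK, hK', isConflation_of_iso hde
      ⟨biprod.fst, biprod.inl, biprod.hom_ext _ _ (by simp) ((isZero_zero C).eq_of_tgt _ _),
        by simp⟩ (Iso.refl _)⟩, hk⟩

/-- Objects with a finite `properRes ω`-coresolution embed in an object of `properRes ω`, with
cone in `cores ω`. -/
theorem exists_preenvelope (hω : IsSubcat ω) {A : C}
    (hA : cores (properRes ω) A) : ∃ (B Z : C) (x : A ⟶ B) (y : B ⟶ Z),
      properRes ω B ∧ cores ω Z ∧ IsConflation x y := by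
  obtain ⟨n, hn⟩ := hA
  induction n generalizing A with
  | zero =>
    obtain ⟨W, hW, ⟨f⟩⟩ := hn
    exact ⟨W, 0, f.hom, 0, hW, le_cores _ _ (hω.zero (isZero_zero C)),
      isConflation_iso_left (isZero_zero C) f⟩
  | succ n ih =>
    obtain ⟨X₀, K, x, y, hX₀, h, hK⟩ := hn
    obtain ⟨B', Z', x', y', hB', hZ', h'⟩ := ih hK
    obtain ⟨X', W, g, f, hW, hX', hgf⟩ := hB'.exists_isConflation
    -- `L` is the cocone of `W ⟶ B' ⟶ Z'`, hence in `cores ω`, and it maps onto `K` with kernel term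
    -- `X'`. Pulling it back along `X₀ ⟶ K` gives `M`, an extension of `X₀` by `X'`.
    obtain ⟨L, d, e, k, hde, hk⟩ := exists_cocone_comp hgf h'
    obtain ⟨M, m₁, e₁, m₂, e₂, hM₁, hM₂⟩ := exists_pullback h hde
    exact ⟨M, L, m₁, e₁, properRes_of_isConflation hω hM₂ hX' hX₀,
      cores_of_isConflation hk hW hZ', hM₁⟩

/-- Objects with a finite `properRes ω`-coresolution are covered by an object of `cores ω`, with
cocone in `properRes ω`. -/
theorem exists_precover (hω : IsSubcat ω) {A : C}
    (hA : cores (properRes ω) A) : ∃ (X L : C) (x : X ⟶ L) (y : L ⟶ A),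
      properRes ω X ∧ cores ω L ∧ IsConflation x y := by
  obtain ⟨B, Z, x, y, hB, hZ, h⟩ := exists_preenvelope hω hA
  obtain ⟨X, W, g, f, hW, hX, hgf⟩ := hB.exists_isConflation
  obtain ⟨L, d, e, k, hde, hk⟩ := exists_cocone_comp hgf h
  exact ⟨X, L, d, e, hX, cores_of_isConflation hk hW hZ, hde⟩

theorem le_leftPerp_properRes : ω ≤ leftPerp (properRes ω) :=
  fun A hA _ hY i ↦ hY.rightPerp A hA i

theorem le_rightPerp_leftPerp (P : ObjectProperty C) : P ≤ rightPerp (leftPerp P) :=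
  fun A hA _ hX i ↦ hX A hA i

theorem leftPerp_properRes_inf_properRes_le (hω : IsSubcat ω) {A : C}
    (hA : leftPerp (properRes ω) A) (hA' : properRes ω A) : ω A := by
  obtain ⟨K, W, g, f, hW, hK, hgf⟩ := hA'.exists_isConflation
  obtain ⟨b⟩ := nonempty_iso_biprod hgf (hA K hK 0)
  exact hω.summand (hω.of_iso (b ≪≫ biprod.braiding K A) hW)

variable [HasEnoughInj.{w} C]

theorem cores_le_leftPerp_properRes (hω : IsSubcat ω) :
    cores ω ≤ leftPerp (properRes ω) := by
  rintro A ⟨n, hn⟩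
  induction n generalizing A with
  | zero =>
    obtain ⟨W, hW, ⟨f⟩⟩ := hn
    exact le_leftPerp_properRes _ (hω.of_iso f.symm hW)
  | succ n ih =>
    obtain ⟨W, K, x, y, hW, h, hK⟩ := hn
    exact leftPerp_cocone h (le_leftPerp_properRes _ hW) (ih K hK)

theorem mem_of_cores_of_rightPerp (hω : IsSubcat ω) {Z : C} (hZ : cores ω Z)
    (hZ' : rightPerp (leftPerp (properRes ω)) Z) : ω Z := by
  obtain ⟨n, hn⟩ := hZ
  cases n with
  | zero =>
    obtain ⟨W, hW, ⟨f⟩⟩ := hn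
    exact hω.of_iso f.symm hW
  | succ n =>
    obtain ⟨W, K, x, y, hW, h, hK⟩ := hn
    obtain ⟨b⟩ := nonempty_iso_biprod h
      (extZero_of_rightPerp hZ' (cores_le_leftPerp_properRes hω K ⟨n, hK⟩))
    exact hω.summand (hω.of_iso b hW)

end Resolutions

end ExtriCat

theorem mainTheorem10 {C : Type u} [Category.{v} C] [Preadditive C]
    [HasZeroObject C] [HasBinaryBiproducts C] [ExtriCat.Extriangulated.{w} C] [ExtriCat.KrullSchmidt C]
    [ExtriCat.HasEnoughProj.{w} C] [ExtriCat.HasEnoughInj.{w} C]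
    (ω : ObjectProperty C) (hω : ExtriCat.IsSubcat ω) (hself : ExtriCat.SelfOrthogonal ω) :
    ExtriCat.leftPerp (ExtriCat.properRes ω) ⊓ ExtriCat.cores (ExtriCat.properRes ω) =
        ExtriCat.cores ω ∧
      ExtriCat.rightPerp (ExtriCat.leftPerp (ExtriCat.properRes ω)) ⊓
          ExtriCat.cores (ExtriCat.properRes ω) =
        ExtriCat.properRes ω := by
  refine ⟨le_antisymm ?_ (le_inf (ExtriCat.cores_le_leftPerp_properRes hω)
    (ExtriCat.cores_mono (ExtriCat.le_properRes hω hself))), le_antisymm ?_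
    (le_inf (ExtriCat.le_rightPerp_leftPerp _) (ExtriCat.le_cores _))⟩
  · rintro A ⟨hA, hA'⟩
    obtain ⟨B, Z, x, y, hB, hZ, h⟩ := ExtriCat.exists_preenvelope hω hA'
    exact ExtriCat.cores_of_isConflation h (ExtriCat.leftPerp_properRes_inf_properRes_le hω
      (ExtriCat.leftPerp_of_isConflation h hA (ExtriCat.cores_le_leftPerp_properRes hω Z hZ)) hB) hZ
  · rintro A ⟨hA, hA'⟩
    obtain ⟨X, L, x, y, hX, hL, h⟩ := ExtriCat.exists_precover hω hA'
    have hL' := ExtriCat.mem_of_cores_of_rightPerp hω hL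
      (ExtriCat.rightPerp_of_isConflation h (ExtriCat.le_rightPerp_leftPerp _ X hX) hA)
    exact ExtriCat.properRes_of_isConflation_weight h hL' hX
      fun W hW i ↦ hA W (ExtriCat.le_leftPerp_properRes W hW) i
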